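/- All rings are commutative and Noetherian with identity. A finitely generated module $M$ over a ring $R$ has constant rank if there is an integer $n\ge 0$ such that $M_{\mathfrak p}\cong R_{\mathfrak p}^{n}$ for every associated prime $\mathfrak p$ of $R$. A ring $R$ satisfies (SAC) if every finitely generated $R$-module $M$ with $\operatorname{Ext}^i_R(M,R)=0$ for all $i>0$ and $\operatorname{Ext}^i_R(M,M)=0$ for all sufficiently large $i$ has $\operatorname{Ext}^i_R(M,M)=0$ for all $i>0$. A ring $R$ satisfies (SACC) if this implication holds for every finitely generated $R$-module $M$ with constant rank. Theorem 2.3. Let $(R,\mathfrak m)$ be a Noetherian local ring and let $x\in\mathfrak m$ be a non-zerodivisor on $R$ (so that $R$ has positive depth). If $R$ satisfies (SACC), then $R/xR$ satisfies (SAC). -/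

import Mathlib

universe u

open CategoryTheory

/-- `Ext^i_R(M, N) = 0`. -/
def ExtVanishes (R : Type u) [CommRing R] (M N : Type u) [AddCommGroup M] [Module R M]
    [AddCommGroup N] [Module R N] (i : ℕ) : Prop :=
  Subsingleton (Abelian.Ext (ModuleCat.of R M) (ModuleCat.of R N) i)

/-- If `Ext^{>0}_R(M, R) = 0` and `Ext^{≫0}_R(M, M) = 0`, then `Ext^{>0}_R(M, M) = 0`. -/
def SymmetricAuslanderFor (R : Type u) [CommRing R] (M : Type u) [AddCommGroup M]
    [Module R M] : Prop :=
  (∀ i : ℕ, 0 < i → ExtVanishes R M R i) →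
  (∃ n : ℕ, ∀ i : ℕ, n < i → ExtVanishes R M M i) →
  ∀ i : ℕ, 0 < i → ExtVanishes R M M i

/-- The symmetric Auslander condition (SAC). -/
def SAC (R : Type u) [CommRing R] : Prop :=
  ∀ (M : Type u) [AddCommGroup M] [Module R M] [Module.Finite R M],
    SymmetricAuslanderFor R M

/-- `M` has constant rank: there is one `n` such that `M_p` is free of rank `n` over `R_p`
for every associated prime `p` of `R`. -/
def HasConstantRank (R : Type u) [CommRing R] (M : Type u) [AddCommGroup M]
    [Module R M] : Prop :=
  ∃ n : ℕ, ∀ (p : Ideal R) [p.IsPrime], p ∈ associatedPrimes R R →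
    Nonempty (LocalizedModule p.primeCompl M ≃ₗ[Localization.AtPrime p]
      (Fin n → Localization.AtPrime p))

/-- The symmetric Auslander condition for modules with constant rank (SACC). -/
def SACC (R : Type u) [CommRing R] : Prop :=
  ∀ (M : Type u) [AddCommGroup M] [Module R M] [Module.Finite R M],
    HasConstantRank R M → SymmetricAuslanderFor R M

/-!
Write `S = R ⧸ (x)`, let `M` be a finitely generated `S`-module, and let `N` be its first syzygy
over `R`, so that `x F ⊆ N ⊆ F` with `F` free. Inverting `x` identifies `N` with `F`, hence `N`
has constant rank. Reducing modulo `x` gives an exact sequence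
`0 → M → S ⊗ N → S ⊗ F → M → 0`, whose leftmost term is `Tor₁(S, M)`; as `x` is regular on `N`,
`Ext_R(N, L) = Ext_S(S ⊗ N, L)` for every `S`-module `L`. The vanishing of `Ext_S^{>0}(M, S)` and
`Ext_S^{≫0}(M, M)` therefore passes to `Ext_R^{>0}(N, R)` and `Ext_R^{≫0}(N, N)`, so (SACC) gives
`Ext_R^{>0}(N, N) = 0`, hence `Ext_S^{>0}(S ⊗ N, M) = 0`. Then `Ext_S^i(M, M)` embeds in
`Ext_S^{i+2}(M, M)` for `i > 0`, and vanishing descends from large degrees to all positive ones.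
-/

open Abelian Function
open scoped TensorProduct

section ShortExactSequences

/-- The sequence of modules `0 → A → B → C → 0` is exact. -/
structure IsShortExact {R A B C : Type*} [Ring R] [AddCommGroup A] [Module R A]
    [AddCommGroup B] [Module R B] [AddCommGroup C] [Module R C]
    (f : A →ₗ[R] B) (g : B →ₗ[R] C) : Prop where
  injective : Injective f
  exact : Exact f g
  surjective : Surjective g

namespace IsShortExact

lemma subtype_ker {R B C : Type*} [Ring R] [AddCommGroup B] [Module R B] [AddCommGroup C]
    [Module R C] {g : B →ₗ[R] C} (hg : Surjective g) :
    IsShortExact (LinearMap.ker g).subtype g :=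
  ⟨Subtype.val_injective, LinearMap.exact_subtype_ker_map g, hg⟩

variable {R : Type u} [CommRing R] {A B C : Type u} [AddCommGroup A] [Module R A]
  [AddCommGroup B] [Module R B] [AddCommGroup C] [Module R C]
  {f : A →ₗ[R] B} {g : B →ₗ[R] C}

lemma shortExact (h : IsShortExact f g) :
    (ModuleCat.shortComplexOfCompEqZero f g h.exact.linearMap_comp_eq_zero).ShortExact :=
  ModuleCat.shortComplex_shortExact _ h.exact h.injective h.surjective

end IsShortExact

lemma subsingleton_of_shortComplex_exact {T : ShortComplex AddCommGrpCat.{u}} (hT : T.Exact)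
    (_ : Subsingleton T.X₁) (_ : Subsingleton T.X₃) : Subsingleton T.X₂ :=
  AddCommGrpCat.subsingleton_of_isZero <| hT.isZero_of_both_zeros
    ((AddCommGrpCat.isZero_of_subsingleton _).eq_of_src _ _)
    ((AddCommGrpCat.isZero_of_subsingleton _).eq_of_tgt _ _)

end ShortExactSequences

section ExtVanishing

variable {R : Type u} [CommRing R] {A B C L : Type u} [AddCommGroup A] [Module R A]
  [AddCommGroup B] [Module R B] [AddCommGroup C] [Module R C] [AddCommGroup L] [Module R L]
  {f : A →ₗ[R] B} {g : B →ₗ[R] C} {i : ℕ}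

namespace IsShortExact

lemma extVanishes_contravariant₁ (h : IsShortExact f g) (hB : ExtVanishes R B L i)
    (hC : ExtVanishes R C L (i + 1)) : ExtVanishes R A L i :=
  subsingleton_of_shortComplex_exact
    (Ext.contravariant_sequence_exact₁' h.shortExact _ i (i + 1) (add_comm 1 i)) hB hC

lemma extVanishes_contravariant₂ (h : IsShortExact f g) (hA : ExtVanishes R A L i)
    (hC : ExtVanishes R C L i) : ExtVanishes R B L i :=
  subsingleton_of_shortComplex_exact
    (Ext.contravariant_sequence_exact₂' h.shortExact _ i) hC hA

lemma extVanishes_contravariant₃ (h : IsShortExact f g) (hA : ExtVanishes R A L i)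
    (hB : ExtVanishes R B L (i + 1)) : ExtVanishes R C L (i + 1) :=
  subsingleton_of_shortComplex_exact
    (Ext.contravariant_sequence_exact₃' h.shortExact _ i (i + 1) (add_comm 1 i)) hA hB

lemma extVanishes_covariant₁ (h : IsShortExact f g) (hC : ExtVanishes R L C i)
    (hB : ExtVanishes R L B (i + 1)) : ExtVanishes R L A (i + 1) :=
  subsingleton_of_shortComplex_exact
    (Ext.covariant_sequence_exact₁' _ h.shortExact i (i + 1) rfl) hC hB

lemma extVanishes_covariant₃ (h : IsShortExact f g) (hB : ExtVanishes R L B i)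
    (hA : ExtVanishes R L A (i + 1)) : ExtVanishes R L C i :=
  subsingleton_of_shortComplex_exact
    (Ext.covariant_sequence_exact₃' _ h.shortExact i (i + 1) rfl) hB hA

end IsShortExact

lemma ExtVanishes.of_projective [Module.Projective R B] : ExtVanishes R B L (i + 1) :=
  have : Projective (ModuleCat.of R B) := ModuleCat.projective_of_categoryTheory_projective _
  Ext.subsingleton_of_projective _ _ _

lemma ExtVanishes.pi {ι : Type} [Finite ι] (h : ExtVanishes R B L i) :
    ExtVanishes R B (ι → L) i := by
  have := Fintype.ofFinite ι
  have : Subsingleton (Ext (ModuleCat.of R B) (ModuleCat.of R L) i) := h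
  have : Subsingleton ((extFunctorObj (ModuleCat.of R B) i).obj (⨁ fun _ : ι ↦ .of R L)) :=
    (Ext.addEquivBiproduct _ (Limits.biproduct.isBilimit _) i).subsingleton
  exact ((extFunctorObj _ i).mapIso (ModuleCat.biproductIsoPi fun _ : ι ↦ ModuleCat.of R L)
    ).addCommGroupIsoToAddEquiv.symm.subsingleton

namespace IsShortExact

lemma extVanishes_add_two_iff [Module.Projective R B] (h : IsShortExact f g) :
    ExtVanishes R C L (i + 2) ↔ ExtVanishes R A L (i + 1) :=
  ⟨h.extVanishes_contravariant₁ .of_projective, (h.extVanishes_contravariant₃ · .of_projective)⟩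

lemma extVanishes_one_iff [Module.Projective R B] (h : IsShortExact f g) :
    ExtVanishes R C L 1 ↔ Surjective (LinearMap.lcomp R L f) := by
  constructor
  · intro hC φ
    obtain ⟨e, he⟩ := Ext.contravariant_sequence_exact₁ h.shortExact (ModuleCat.of R L)
      (Ext.mk₀ (ModuleCat.ofHom φ)) (add_zero 1) (hC.elim _ _)
    obtain ⟨ψ, rfl⟩ := (Ext.mk₀_bijective _ _).surjective e
    rw [Ext.mk₀_comp_mk₀] at he
    exact ⟨ψ.hom, congrArg ModuleCat.Hom.hom ((Ext.mk₀_bijective _ _).injective he)⟩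
  · refine fun hf ↦ subsingleton_of_forall_eq 0 fun e ↦ ?_
    obtain ⟨e₀, rfl⟩ := Ext.contravariant_sequence_exact₃ h.shortExact (ModuleCat.of R L) e
      (Subsingleton.elim (h := ExtVanishes.of_projective (B := B) (i := 0)) _ _) (add_zero 1)
    obtain ⟨φ, rfl⟩ := (Ext.mk₀_bijective _ _).surjective e₀
    obtain ⟨ψ, hψ⟩ := hf φ.hom
    have hφ : φ = ModuleCat.ofHom f ≫ ModuleCat.ofHom ψ := ModuleCat.hom_ext hψ.symm
    rw [hφ, ← Ext.mk₀_comp_mk₀]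
    exact h.shortExact.extClass_comp_assoc _

lemma extVanishes_of_smul_eq_zero {x : R} {q : L →ₗ[R] C}
    (h : IsShortExact (LinearMap.lsmul R L x) q) (hB : ∀ b : B, x • b = 0)
    (hC : ExtVanishes R B C i) : ExtVanishes R B L i := by
  refine subsingleton_of_forall_eq 0 fun e ↦ ?_
  obtain ⟨e', rfl⟩ := Ext.covariant_sequence_exact₂ _ h.shortExact e (hC.elim _ _)
  have hx : x • 𝟙 (ModuleCat.of R B) = 0 := ModuleCat.hom_ext (LinearMap.ext hB)
  calc e'.comp (Ext.mk₀ (x • 𝟙 (ModuleCat.of R L))) (add_zero i)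
      = (Ext.mk₀ (x • 𝟙 (ModuleCat.of R B))).comp e' (zero_add i) := by
        rw [Ext.mk₀_smul, Ext.comp_smul, Ext.comp_mk₀_id, Ext.mk₀_smul, Ext.smul_comp,
          Ext.mk₀_id_comp]
    _ = 0 := by rw [hx, Ext.mk₀_zero, Ext.zero_comp]

end IsShortExact

end ExtVanishing

section ReductionModuloRegularElement

variable {R S : Type*} [CommRing R] [CommRing S] [Algebra R S] {x : R}

lemma smul_eq_zero_of_exact (hS : Exact (LinearMap.lsmul R R x) (Algebra.linearMap R S))
    {L : Type*} [AddCommGroup L] [Module R L] [Module S L] [IsScalarTower R S L] (l : L) :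
    x • l = 0 := by
  have hx : algebraMap R S x = 0 := by simpa using hS.apply_apply_eq_zero 1
  rw [← algebraMap_smul S, hx, zero_smul]

lemma isShortExact_lsmul_mk (hS : IsShortExact (LinearMap.lsmul R R x) (Algebra.linearMap R S))
    {N : Type*} [AddCommGroup N] [Module R N] (hN : IsSMulRegular N x) :
    IsShortExact (LinearMap.lsmul R N x) (TensorProduct.mk R S N 1) where
  injective := hN
  exact := by
    refine .of_ladder_linearEquiv_of_exact (e₁ := TensorProduct.lid R N)
      (e₂ := TensorProduct.lid R N) (e₃ := .refl R _) ?_ ?_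
      (rTensor_exact N hS.exact hS.surjective) <;> ext <;> simp
  surjective := TensorProduct.mk_surjective R N S hS.surjective

lemma exists_linearMap_comp_eq_of_ker_le (hS : Surjective (algebraMap R S)) {B C L : Type*}
    [AddCommGroup B] [Module R B] [AddCommGroup C] [Module R C] [Module S C] [IsScalarTower R S C]
    [AddCommGroup L] [Module R L] [Module S L] [IsScalarTower R S L]
    {g : B →ₗ[R] C} (hg : Surjective g) {φ : B →ₗ[R] L} (h : LinearMap.ker g ≤ LinearMap.ker φ) :
    ∃ ψ : C →ₗ[S] L, ψ.restrictScalars R ∘ₗ g = φ := by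
  let e := g.quotKerEquivOfSurjective hg
  refine ⟨((LinearMap.ker g).liftQ φ h ∘ₗ e.symm.toLinearMap).extendScalarsOfSurjective hS,
    LinearMap.ext fun b ↦ ?_⟩
  exact congrArg ((LinearMap.ker g).liftQ φ h) (e.symm_apply_apply (Submodule.Quotient.mk b))

variable {A B C : Type*} [AddCommGroup A] [Module R A] [AddCommGroup B] [Module R B]
  [AddCommGroup C] [Module R C] {f : A →ₗ[R] B} {g : B →ₗ[R] C}

namespace IsShortExact

lemma baseChange (h : IsShortExact f g) (hB : IsSMulRegular B x) (hC : IsSMulRegular C x)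
    (hS : IsShortExact (LinearMap.lsmul R R x) (Algebra.linearMap R S)) :
    IsShortExact (f.baseChange S) (g.baseChange S) where
  injective := by
    refine (injective_iff_map_eq_zero _).2 fun t ht ↦ ?_
    obtain ⟨a, rfl⟩ := TensorProduct.mk_surjective R A S hS.surjective t
    obtain ⟨b, hb : x • b = f a⟩ := ((isShortExact_lsmul_mk hS hB).exact (f a)).1 ht
    have hgb : g b = 0 := hC.right_eq_zero_of_smul <| by
      rw [← map_smul, hb, h.exact.apply_apply_eq_zero]
    obtain ⟨a', rfl⟩ := (h.exact b).1 hgb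
    obtain rfl : x • a' = a := h.injective (by rw [map_smul, hb])
    exact ((isShortExact_lsmul_mk hS (hB.of_injective f h.injective)).exact _).2 ⟨a', rfl⟩
  exact := lTensor_exact S h.exact h.surjective
  surjective := LinearMap.lTensor_surjective S h.surjective

lemma exists_comp_eq_smul (h : IsShortExact f g) (hC : ∀ c : C, x • c = 0) :
    ∃ μ : B →ₗ[R] A, ∀ b, f (μ b) = x • b := by
  have hx (b : B) : x • b ∈ LinearMap.range f := (h.exact _).1 (by rw [map_smul, hC])
  exact ⟨LinearMap.codRestrictOfInjective (LinearMap.lsmul R B x) f h.injective hx,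
    LinearMap.codRestrictOfInjective_comp_apply _ _ _ _⟩

variable [Module S C] [IsScalarTower R S C]

-- `C` is `Tor₁(S, C)`, and `d` is the connecting homomorphism.
lemma exists_isShortExact_rangeRestrict (h : IsShortExact f g) (hB : IsSMulRegular B x)
    (hS : IsShortExact (LinearMap.lsmul R R x) (Algebra.linearMap R S)) :
    ∃ d : C →ₗ[S] S ⊗[R] A,
      IsShortExact (C := LinearMap.range (f.baseChange S)) d (f.baseChange S).rangeRestrict := by
  have hA' := isShortExact_lsmul_mk hS (hB.of_injective f h.injective)
  have hB' := isShortExact_lsmul_mk hS hB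
  obtain ⟨μ, hμ⟩ := h.exists_comp_eq_smul (smul_eq_zero_of_exact hS.exact)
  have hμf (a : A) : μ (f a) = x • a := h.injective (by rw [hμ, map_smul])
  obtain ⟨d, hd⟩ := exists_linearMap_comp_eq_of_ker_le (S := S) hS.surjective h.surjective
    (φ := TensorProduct.mk R S A 1 ∘ₗ μ) <| by
      rw [h.exact.linearMap_ker_eq]
      rintro _ ⟨a, rfl⟩
      exact (hA'.exact _).2 ⟨a, (hμf a).symm⟩
  replace hd (b : B) : d (g b) = 1 ⊗ₜ μ b := LinearMap.congr_fun hd b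
  refine ⟨d, (injective_iff_map_eq_zero d).2 fun c hc ↦ ?_, fun t ↦ ?_,
    LinearMap.surjective_rangeRestrict _⟩
  · obtain ⟨b, rfl⟩ := h.surjective c
    obtain ⟨a, ha : x • a = μ b⟩ := (hA'.exact _).1 ((hd b).symm.trans hc)
    have hab : f a = b := hB (by simp only [← map_smul, ha, hμ])
    rw [← hab, h.exact.apply_apply_eq_zero]
  · obtain ⟨a, rfl⟩ := TensorProduct.mk_surjective R A S hS.surjective t
    refine ⟨fun hfa ↦ ?_, ?_⟩
    · obtain ⟨b, hb : x • b = f a⟩ := (hB'.exact _).1 (congrArg Subtype.val hfa)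
      obtain rfl : μ b = a := h.injective (by rw [hμ, hb])
      exact ⟨g b, hd b⟩
    · rintro ⟨c, hc⟩
      obtain ⟨b, rfl⟩ := h.surjective c
      rw [← hc, hd]
      exact Subtype.ext ((hB'.exact _).2 ⟨b, (hμ b).symm⟩)

lemma isShortExact_range_baseChange (h : IsShortExact f g) (hS : Surjective (algebraMap R S)) :
    IsShortExact (A := LinearMap.range (f.baseChange S)) (Submodule.subtype _)
      (g.liftBaseChange S) where
  injective := Subtype.val_injective
  exact t := by
    have hgf : g.liftBaseChange S ∘ₗ f.baseChange S = 0 := by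
      ext a
      simp [h.exact.apply_apply_eq_zero]
    refine ⟨fun ht ↦ ?_, ?_⟩
    · obtain ⟨b, rfl⟩ := TensorProduct.mk_surjective R B S hS t
      obtain ⟨a, rfl⟩ := (h.exact b).1 (by simpa using ht)
      exact ⟨⟨_, 1 ⊗ₜ a, rfl⟩, rfl⟩
    · rintro ⟨⟨_, a, rfl⟩, rfl⟩
      exact LinearMap.congr_fun hgf a
  surjective c := by
    obtain ⟨b, rfl⟩ := h.surjective c
    exact ⟨1 ⊗ₜ b, by simp⟩

end IsShortExact

end ReductionModuloRegularElement

section ChangeOfRings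

variable {R S : Type u} [CommRing R] [CommRing S] [Algebra R S] {x : R}
  {A B C L : Type u} [AddCommGroup A] [Module R A] [AddCommGroup B] [Module R B]
  [AddCommGroup C] [Module R C] [AddCommGroup L] [Module R L] [Module S L] [IsScalarTower R S L]
  {f : A →ₗ[R] B} {g : B →ₗ[R] C} {i : ℕ}

lemma IsShortExact.extVanishes_one_iff_baseChange [Module.Projective R B] (h : IsShortExact f g)
    (hS : IsShortExact (f.baseChange S) (g.baseChange S)) :
    ExtVanishes R C L 1 ↔ ExtVanishes S (S ⊗[R] C) L 1 := by
  have adjunction : LinearMap.lcomp S L (f.baseChange S) ∘ LinearMap.liftBaseChangeEquiv S =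
      LinearMap.liftBaseChangeEquiv S ∘ LinearMap.lcomp R L f := by
    ext φ
    simp
  rw [h.extVanishes_one_iff, hS.extVanishes_one_iff,
    ← (LinearMap.liftBaseChangeEquiv S).surjective.of_comp_iff, adjunction,
    EquivLike.comp_surjective]

theorem extVanishes_iff_baseChange
    (hS : IsShortExact (LinearMap.lsmul R R x) (Algebra.linearMap R S))
    {N : Type u} [AddCommGroup N] [Module R N] (hN : IsSMulRegular N x) (i : ℕ) :
    ExtVanishes R N L (i + 1) ↔ ExtVanishes S (S ⊗[R] N) L (i + 1) := by
  have h := IsShortExact.subtype_ker (Finsupp.linearCombination_id_surjective R N)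
  have hF : IsSMulRegular (N →₀ R) x := .finsupp hS.injective
  have h' := h.baseChange hF hN hS
  cases i with
  | zero => exact h.extVanishes_one_iff_baseChange h'
  | succ i =>
    rw [h.extVanishes_add_two_iff, h'.extVanishes_add_two_iff]
    exact extVanishes_iff_baseChange hS (hF.of_injective _ h.injective) i

variable [Module S C] [IsScalarTower R S C]

namespace IsShortExact

variable [Module.Projective R B]

lemma extVanishes_syzygy (h : IsShortExact f g) (hB : IsSMulRegular B x)
    (hS : IsShortExact (LinearMap.lsmul R R x) (Algebra.linearMap R S))
    (h₁ : ExtVanishes S C L (i + 1)) (h₂ : ExtVanishes S C L (i + 2)) :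
    ExtVanishes R A L (i + 1) := by
  obtain ⟨d, hd⟩ := h.exists_isShortExact_rangeRestrict hB hS
  rw [extVanishes_iff_baseChange hS (hB.of_injective f h.injective)]
  exact hd.extVanishes_contravariant₂ h₁
    ((h.isShortExact_range_baseChange hS.surjective).extVanishes_add_two_iff.1 h₂)

lemma extVanishes_of_syzygy (h : IsShortExact f g) (hB : IsSMulRegular B x)
    (hS : IsShortExact (LinearMap.lsmul R R x) (Algebra.linearMap R S))
    (hA : ExtVanishes R A L (i + 1)) (h₃ : ExtVanishes S C L (i + 3)) :
    ExtVanishes S C L (i + 1) := by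
  obtain ⟨d, hd⟩ := h.exists_isShortExact_rangeRestrict hB hS
  rw [extVanishes_iff_baseChange hS (hB.of_injective f h.injective)] at hA
  exact hd.extVanishes_contravariant₁ hA
    ((h.isShortExact_range_baseChange hS.surjective).extVanishes_add_two_iff.1 h₃)

lemma extVanishes_syzygy_self (h : IsShortExact f g) (hB : IsSMulRegular B x)
    (hS : IsShortExact (LinearMap.lsmul R R x) (Algebra.linearMap R S))
    (h₁ : ExtVanishes S C S (i + 1)) (h₂ : ExtVanishes S C S (i + 2)) :
    ExtVanishes R A R (i + 1) := by
  have hCS : ExtVanishes R C S (i + 2) :=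
    h.extVanishes_add_two_iff.2 (h.extVanishes_syzygy hB hS h₁ h₂)
  have hCR : ExtVanishes R C R (i + 2) :=
    hS.extVanishes_of_smul_eq_zero (smul_eq_zero_of_exact hS.exact) hCS
  exact h.extVanishes_add_two_iff.1 hCR

end IsShortExact

lemma forall_of_add_two_of_eventually {P : ℕ → Prop} (step : ∀ i, P (i + 2) → P i)
    (eventually : ∃ n, ∀ i, n < i → P i) (i : ℕ) : P i := by
  obtain ⟨n, hn⟩ := eventually
  have descend (k : ℕ) : P (i + 2 * k) → P i := by
    induction k with
    | zero => exact id
    | succ k ih => exact fun h ↦ ih (step _ h)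
  exact descend (n + 1) (hn _ (by omega))

theorem SymmetricAuslanderFor.of_syzygy
    (hS : IsShortExact (LinearMap.lsmul R R x) (Algebra.linearMap R S)) {ι : Type} [Finite ι]
    {f : A →ₗ[R] ι → R} {g : (ι → R) →ₗ[R] C} (h : IsShortExact f g)
    (hA : SymmetricAuslanderFor R A) : SymmetricAuslanderFor S C := by
  rintro hCS ⟨n, hCC⟩
  have hF : IsSMulRegular (ι → R) x := .pi fun _ ↦ hS.injective
  have hAR (i : ℕ) : ExtVanishes R A R (i + 1) :=
    h.extVanishes_syzygy_self hF hS (hCS _ (by omega)) (hCS _ (by omega))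
  have hAA_eventually (i : ℕ) (hi : n + 1 < i) : ExtVanishes R A A i := by
    obtain ⟨j, rfl⟩ := Nat.exists_eq_add_of_le' (show 2 ≤ i by omega)
    exact h.extVanishes_covariant₁
      (h.extVanishes_syzygy hF hS (hCC _ (by omega)) (hCC _ (by omega))) (hAR _).pi
  have hAA : ∀ i, 0 < i → ExtVanishes R A A i :=
    hA (fun i hi ↦ Nat.sub_add_cancel hi ▸ hAR (i - 1)) ⟨n + 1, hAA_eventually⟩
  have hAC (i : ℕ) : ExtVanishes R A C (i + 1) :=
    h.extVanishes_covariant₃ (hAR i).pi (hAA _ (by omega))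
  have hCC_all (i : ℕ) : ExtVanishes S C C (i + 1) :=
    forall_of_add_two_of_eventually (P := fun i ↦ ExtVanishes S C C (i + 1))
      (fun i ↦ h.extVanishes_of_syzygy hF hS (hAC i)) ⟨n, fun i hi ↦ hCC _ (by omega)⟩ i
  exact fun i hi ↦ Nat.sub_add_cancel hi ▸ hCC_all (i - 1)

end ChangeOfRings

section ConstantRank

variable {R : Type u} [CommRing R]

lemma notMem_of_mem_associatedPrimes {x : R} (hx : x ∈ nonZeroDivisors R) {p : Ideal R}
    (hp : p ∈ associatedPrimes R R) : x ∉ p := by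
  obtain ⟨hprime, y, rfl⟩ := hp
  rintro ⟨n, hn⟩
  have hy : y = 0 := by
    rw [Submodule.mem_colon_singleton, Submodule.mem_bot, smul_eq_mul] at hn
    exact (mem_nonZeroDivisors_iff.1 (pow_mem hx n)).1 y hn
  exact hprime.ne_top (by simp [hy])

lemma isLocalizedModule_comp_subtype {T : Submonoid R} {V W : Type*} [AddCommGroup V] [Module R V]
    [AddCommGroup W] [Module R W] (g : V →ₗ[R] W) [IsLocalizedModule T g] {N : Submodule R V}
    {s : R} (hs : s ∈ T) (hN : ∀ v : V, s • v ∈ N) : IsLocalizedModule T (g ∘ₗ N.subtype) where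
  map_units := IsLocalizedModule.map_units g
  surj w := by
    obtain ⟨⟨v, t⟩, ht : t.1 • w = g v⟩ := IsLocalizedModule.surj T g w
    refine ⟨⟨⟨s • v, hN v⟩, ⟨s, hs⟩ * t⟩, ?_⟩
    change (s * t.1) • w = g (s • v)
    rw [mul_smul, ht, map_smul]
  exists_of_eq h := by
    obtain ⟨t, ht⟩ := IsLocalizedModule.exists_of_eq (S := T) (f := g) h
    exact ⟨t, Subtype.ext ht⟩

theorem hasConstantRank_of_smul_mem {x : R} (hx : x ∈ nonZeroDivisors R) {n : ℕ}
    {N : Submodule R (Fin n → R)} (hN : ∀ v, x • v ∈ N) : HasConstantRank R N := by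
  refine ⟨n, fun p _ hp ↦ ?_⟩
  let g : (Fin n → R) →ₗ[R] (Fin n → Localization.AtPrime p) :=
    .pi fun i ↦ Algebra.linearMap R (Localization.AtPrime p) ∘ₗ .proj i
  have : IsLocalizedModule p.primeCompl (g ∘ₗ N.subtype) :=
    isLocalizedModule_comp_subtype g (notMem_of_mem_associatedPrimes hx hp) hN
  exact ⟨(IsLocalizedModule.iso p.primeCompl (g ∘ₗ N.subtype)).extendScalarsOfIsLocalization
    p.primeCompl _⟩

end ConstantRank

lemma isShortExact_lsmul_quotient_span_singleton {R : Type u} [CommRing R] {x : R}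
    (hx : x ∈ nonZeroDivisors R) :
    IsShortExact (LinearMap.lsmul R R x) (Algebra.linearMap R (R ⧸ Ideal.span {x})) where
  injective := (isRegular_iff_mem_nonZeroDivisors.2 hx).left
  exact r := by
    simp [Ideal.Quotient.eq_zero_iff_mem, Ideal.mem_span_singleton', mul_comm]
  surjective := Ideal.Quotient.mk_surjective

theorem theorem2p3_general (R : Type u) [CommRing R] [IsNoetherianRing R]
    (x : R) (hx : x ∈ nonZeroDivisors R) (hR : SACC R) : SAC (R ⧸ Ideal.span {x}) := by
  intro M _ _ _
  let : Module R M := Module.compHom M (Ideal.Quotient.mk (Ideal.span {x}))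
  have : IsScalarTower R (R ⧸ Ideal.span {x}) M := .of_algebraMap_smul fun _ _ ↦ rfl
  have : Module.Finite R M := .trans (R ⧸ Ideal.span {x}) M
  have hS := isShortExact_lsmul_quotient_span_singleton hx
  obtain ⟨n, π, hπ⟩ := Module.Finite.exists_fin' R M
  have hrank : HasConstantRank R (LinearMap.ker π) := hasConstantRank_of_smul_mem hx fun v ↦ by
    rw [LinearMap.mem_ker, map_smul, smul_eq_zero_of_exact hS.exact]
  exact .of_syzygy hS (.subtype_ker hπ) (hR _ hrank)

theorem theorem2p3 (R : Type u) [CommRing R] [IsNoetherianRing R] [IsLocalRing R]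
    (x : R) (hxm : x ∈ IsLocalRing.maximalIdeal R) (hx : x ∈ nonZeroDivisors R)
    (hR : SACC R) : SAC (R ⧸ Ideal.span {x}) :=
  theorem2p3_general R x hx hR
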